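/- There is an absolute constant $C>0$ such that the following holds for all integers $n\ge 2$ and $1\le k\le n$, all $\varepsilon\in(0,\tfrac12)$ and all real $p\in[2,\infty)$. There exist positive integers $d\le m$ and real numbers $a,b$ with $|a|,|b|\le Cp$ such that $$m = p^{a}\cdot\frac{k^p}{\varepsilon^2}\cdot(\log n)^{p-1}\qquad\text{and}\qquad d = p^{b}\cdot\frac{k^{p-1}}{\varepsilon}\cdot(\log n)^{p-1}$$ (that is, $m=p^{O(p)}\frac{k^p}{\varepsilon^2}\log^{p-1}n$ and $d=p^{O(p)}\frac{k^{p-1}}{\varepsilon}\log^{p-1}n\le m$), and such that the following is true. Let $A$ be the random $m\times n$ matrix obtained by choosing, independently for each column, a set of $d$ of the $m$ rows uniformly at random (without replacement), and putting the value $d^{-1/p}$ in the chosen positions of that column and $0$ in all other positions. Then with probability at least $98\%$, simultaneously for all $x\in\mathbb{R}^n$ with at most $k$ nonzero coordinates, $$(1-\varepsilon)\|x\|_p^p\;\le\;\|Ax\|_p^p\;\le\;(1+\varepsilon)\|x\|_p^p .$$ Here $\|\cdot\|_p$ is the $\ell_p$ norm and $\log$ is the natural logarithm. -/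

import Mathlib

open MeasureTheory ProbabilityTheory

noncomputable section

/-- The law of the supports of the `n` columns of a random binary `m × n` matrix of sparsity `d`:
the supports are independent, and each is uniform among the `d`-element sets of rows (that is,
`d` distinct rows chosen uniformly at random without replacement). -/
def columnSupportLaw (m n d : ℕ) : Measure (Fin n → Finset (Fin m)) :=
  Measure.pi fun _ => uniformOn {S : Finset (Fin m) | S.card = d}

/-- The `m × n` matrix whose column `j` has the value `d ^ (-1 / p)` in the rows that belong to
`S j`, and zeros elsewhere. -/
def binaryMatrix (p : ℝ) {m n : ℕ} (d : ℕ) (S : Fin n → Finset (Fin m)) :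
    Matrix (Fin m) (Fin n) ℝ :=
  Matrix.of fun i j => if i ∈ S j then (d : ℝ) ^ (-1 / p) else 0

/-- A vector is `k`-sparse if it has at most `k` nonzero coordinates. -/
def IsSparse (k : ℕ) {n : ℕ} (x : Fin n → ℝ) : Prop :=
  hammingNorm x ≤ k

/-- The `ℓ_p` norm of a real vector, for a real exponent `p`. -/
def lpNormVec (p : ℝ) {n : ℕ} (x : Fin n → ℝ) : ℝ :=
  ‖WithLp.toLp (ENNReal.ofReal p) x‖

end

/-! Fix a set T of k columns containing the support of x, and let h be the number of columns of T
meeting a given row. Both inequalities are deterministic once every j in T has few collisions: the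
sum of h^(p-1) - 1 over the rows of column j, which is `excess`, must be at most εd. The power mean
inequality gives |∑ x_j|^p ≤ h^(p-1) ∑ |x_j|^p, and conversely |∑ x_j|^p ≥ (2 - h^(p-1)) ∑ |x_j|^p.
Regrouping by columns turns both into the claim (`norm_bounds_of_excess_le`).

The excess is controlled by an exponential moment. With X the number of other columns of T through a
row, exp(λ((1+X)^(p-1) - 1)) is at most 1 + α(9^X - 1) with α = 4λp^p (`exp_mul_rpow_sub_one_le`).
The mean of the product of these bounds over the rows of column j is at most what independent
entries would give (`integral_prod_hits_le`). Markov's inequality then yields a tail n^(-8k), which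
beats the at most n^(2k) pairs (T, j). -/

/-! ### Uniform random d-subsets -/

/-- The uniform law on the `d`-element subsets of `Fin m`. -/
noncomputable abbrev sliceLaw (m d : ℕ) : Measure (Finset (Fin m)) :=
  uniformOn {S : Finset (Fin m) | S.card = d}

lemma coe_powersetCard_univ (m d : ℕ) :
    ((Finset.univ : Finset (Fin m)).powersetCard d : Set (Finset (Fin m))) = {S | S.card = d} := by
  ext S; simp

lemma isProbabilityMeasure_sliceLaw {m d : ℕ} (h : d ≤ m) :
    IsProbabilityMeasure (sliceLaw m d) := by
  apply isProbabilityMeasure_uniformOn (Set.toFinite _)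
  rw [← coe_powersetCard_univ, Finset.coe_nonempty]
  exact Finset.powersetCard_nonempty.2 (by simpa using h)

lemma sliceLaw_real_singleton_of_card_ne {m d : ℕ} {S : Finset (Fin m)} (h : S.card ≠ d) :
    (sliceLaw m d).real {S} = 0 := by
  classical
  have := uniformOn_apply_finset (s := (Finset.univ : Finset (Fin m)).powersetCard d) (t := {S})
  rw [coe_powersetCard_univ, Finset.coe_singleton] at this
  rw [measureReal_def, sliceLaw, this, Finset.inter_singleton_of_notMem (by simpa using h)]
  simp

/-- The left side is the product of (d-i)/(m-i) for i < v, and each factor is at most d/m. -/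
lemma choose_sub_sub_div_choose_le {m d v : ℕ} (hd : d ≤ m) (hv : v ≤ d) :
    ((m - v).choose (d - v) : ℝ) / m.choose d ≤ ((d : ℝ) / m) ^ v := by
  have hpos : (0 : ℝ) < m.choose d := by exact_mod_cast Nat.choose_pos hd
  induction v with
  | zero => simp [hpos.ne']
  | succ v ih =>
    obtain ⟨m', hm'⟩ : ∃ m', m = v + 1 + m' := Nat.exists_eq_add_of_le (hv.trans hd)
    obtain ⟨d', hd'⟩ : ∃ d', d = v + 1 + d' := Nat.exists_eq_add_of_le hv
    have hstep : ((m' + 1 : ℕ) : ℝ) * (m - (v + 1)).choose (d - (v + 1)) =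
        ((d' + 1 : ℕ) : ℝ) * (m - v).choose (d - v) := by
      have h := Nat.add_one_mul_choose_eq m' d'
      rw [show m - (v + 1) = m' by omega, show d - (v + 1) = d' by omega,
        show m - v = m' + 1 by omega, show d - v = d' + 1 by omega]
      exact_mod_cast h.trans (mul_comm _ _)
    have hm0 : (0 : ℝ) < m := by rw [hm']; positivity
    have hq : ((d' + 1 : ℕ) : ℝ) / (m' + 1 : ℕ) ≤ d / m := by
      rw [div_le_div_iff₀ (by positivity) hm0]
      have : d' ≤ m' := by omega
      rw [hm', hd']; push_cast
      have : (d' : ℝ) ≤ m' := by exact_mod_cast this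
      nlinarith [(Nat.cast_nonneg v : (0 : ℝ) ≤ v)]
    have hm1 : (0 : ℝ) < ((m' + 1 : ℕ) : ℝ) := by positivity
    calc ((m - (v + 1)).choose (d - (v + 1)) : ℝ) / m.choose d
        = ((m - v).choose (d - v) : ℝ) / m.choose d * (((d' + 1 : ℕ) : ℝ) / (m' + 1 : ℕ)) := by
          rw [div_mul_div_comm, div_eq_div_iff hpos.ne' (by positivity)]
          linear_combination (m.choose d : ℝ) * hstep
      _ ≤ ((d : ℝ) / m) ^ v * (d / m) := by
          gcongr
          exact ih (by omega)
      _ = _ := (pow_succ _ _).symm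

lemma sliceLaw_real_superset_le {m d : ℕ} (hd : d ≤ m) (V : Finset (Fin m)) :
    (sliceLaw m d).real {S | V ⊆ S} ≤ ((d : ℝ) / m) ^ V.card := by
  classical
  have h := uniformOn_apply_finset (s := (Finset.univ : Finset (Fin m)).powersetCard d)
    (t := Finset.univ.filter (V ⊆ ·))
  rw [coe_powersetCard_univ, Finset.coe_filter_univ] at h
  have hcard : ((Finset.univ : Finset (Fin m)).powersetCard d ∩ Finset.univ.filter (V ⊆ ·)) =
      ((Finset.univ : Finset (Fin m)).powersetCard d).filter (V ⊆ ·) := by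
    ext; simp
  rw [measureReal_def, sliceLaw, h, hcard, ENNReal.toReal_div, Finset.card_powersetCard]
  simp only [ENNReal.toReal_natCast, Finset.card_univ, Fintype.card_fin]
  by_cases hv : V.card ≤ d
  · rw [Finset.card_filter_powersetCard_subset _ _ _ (Finset.subset_univ _) hv]
    simpa using choose_sub_sub_div_choose_le hd hv
  · rw [Finset.filter_false_of_mem]
    · simp; positivity
    · intro S hS hVS
      have := Finset.card_le_card hVS
      simp at hS
      omega

/-- Expanding (1+c)^|U ∩ S| over the subsets V of U contained in S leaves only inclusion
probabilities. These are at most those of independent Bernoulli(d/m) entries, and c ≥ 0 preserves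
the inequality. -/
lemma integral_one_add_pow_card_inter_le {m d : ℕ} (hd : d ≤ m) {c : ℝ} (hc : 0 ≤ c)
    (U : Finset (Fin m)) :
    ∫ S, (1 + c) ^ (U ∩ S).card ∂sliceLaw m d ≤ (1 + c * (d / m)) ^ U.card := by
  classical
  have := isProbabilityMeasure_sliceLaw hd
  have hexp (S : Finset (Fin m)) : (1 + c) ^ (U ∩ S).card =
      ∑ V ∈ U.powerset, c ^ V.card * ({S | V ⊆ S} : Set (Finset (Fin m))).indicator 1 S := by
    rw [← Finset.prod_const, Finset.prod_one_add, ← Finset.sum_filter_add_sum_filter_not U.powerset (· ⊆ S)]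
    rw [Finset.sum_eq_zero (s := U.powerset.filter (¬ · ⊆ S)), add_zero]
    · refine Finset.sum_congr ?_ ?_
      · ext V; simp only [Finset.mem_powerset, Finset.mem_filter, Finset.subset_inter_iff]
      · intro V hV
        simp only [Finset.mem_filter] at hV
        simp [hV.2]
    · intro V hV
      simp only [Finset.mem_filter] at hV
      simp [hV.2]
  simp_rw [hexp]
  rw [integral_finsetSum _ fun _ _ => Integrable.of_finite]
  calc _ = ∑ V ∈ U.powerset, c ^ V.card * (sliceLaw m d).real {S | V ⊆ S} := by
        refine Finset.sum_congr rfl fun V _ => ?_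
        rw [integral_const_mul, integral_indicator_one (Set.toFinite _).measurableSet]
    _ ≤ ∑ V ∈ U.powerset, c ^ V.card * ((d : ℝ) / m) ^ V.card := by
        gcongr
        exact sliceLaw_real_superset_le hd _
    _ = _ := by
        simp_rw [← mul_pow, ← Finset.prod_const]
        rw [Finset.prod_one_add]

/-! ### Collisions between columns -/

/-- The number of columns in `T` whose support contains row `i`. -/
def hits {m n : ℕ} (S : Fin n → Finset (Fin m)) (T : Finset (Fin n)) (i : Fin m) : ℕ :=
  (T.filter (i ∈ S ·)).card

lemma prod_pow_hits {m n : ℕ} (S : Fin n → Finset (Fin m)) (T : Finset (Fin n))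
    (U : Finset (Fin m)) (c : ℝ) :
    ∏ i ∈ U, c ^ hits S T i = ∏ l ∈ T, c ^ (U ∩ S l).card := by
  classical
  rw [Finset.prod_pow_eq_pow_sum, Finset.prod_pow_eq_pow_sum]
  congr 1
  simp_rw [hits, Finset.card_filter]
  rw [Finset.sum_comm]
  refine Finset.sum_congr rfl fun l _ => ?_
  rw [← Finset.card_filter, Finset.filter_mem_eq_inter]

/-- Each factor is the convex combination α(1+c)^hits + (1-α), so the product expands over subsets U
of S j with nonnegative weights. Once S j = A is fixed, `prod_pow_hits` turns a product over
dependent rows into one over independent columns. -/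
lemma integral_prod_hits_le {m n d : ℕ} (hd : d ≤ m) {c α : ℝ} (hc : 0 ≤ c) (hα : 0 ≤ α)
    (hα1 : α ≤ 1) {T : Finset (Fin n)} {j : Fin n} (hj : j ∉ T) :
    ∫ S, ∏ i ∈ S j, (1 + α * ((1 + c) ^ hits S T i - 1)) ∂columnSupportLaw m n d ≤
      (1 + α * ((1 + c * (d / m)) ^ T.card - 1)) ^ d := by
  classical
  have := isProbabilityMeasure_sliceLaw hd
  set B := (1 + c * ((d : ℝ) / m)) ^ T.card with hB
  -- The factor of column l: the event S j = A for l = j, the weight of l in T, and 1 otherwise.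
  let F (A U : Finset (Fin m)) (l : Fin n) (R : Finset (Fin m)) : ℝ :=
    if l = j then ({A} : Set (Finset (Fin m))).indicator 1 R
    else if l ∈ T then (1 + c) ^ (U ∩ R).card else 1
  have hF (S : Fin n → Finset (Fin m)) (A U : Finset (Fin m)) : ∏ l, F A U l (S l) =
      ({A} : Set (Finset (Fin m))).indicator 1 (S j) * ∏ l ∈ T, (1 + c) ^ (U ∩ S l).card := by
    rw [← Finset.mul_prod_erase _ _ (Finset.mem_univ j)]
    congr 1
    · simp [F]
    · symm
      refine Finset.prod_subset_one_on_sdiff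
        (fun l hl => by simpa using fun h : l = j => hj (h ▸ hl)) ?_ ?_
      · intro l hl
        simp only [Finset.mem_sdiff, Finset.mem_erase] at hl
        simp [F, hl.1.1, hl.2]
      · intro l hl
        have : l ≠ j := fun h => hj (h ▸ hl)
        simp [F, this, hl]
  have hFint (A U : Finset (Fin m)) : ∫ S, ∏ l, F A U l (S l) ∂columnSupportLaw m n d ≤
      (sliceLaw m d).real {A} * B ^ U.card := by
    rw [columnSupportLaw, integral_fintype_prod_eq_prod (𝕜 := ℝ) (F A U),
      ← Finset.mul_prod_erase _ _ (Finset.mem_univ j)]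
    have h1 : ∫ R, F A U j R ∂sliceLaw m d = (sliceLaw m d).real {A} := by
      simp only [F, if_true]
      exact integral_indicator_one (measurableSet_singleton _)
    rw [h1]
    refine mul_le_mul_of_nonneg_left ?_ measureReal_nonneg
    have h2 : ∏ l ∈ Finset.univ.erase j, ∫ R, F A U l R ∂sliceLaw m d =
        ∏ l ∈ T, ∫ R, (1 + c) ^ (U ∩ R).card ∂sliceLaw m d := by
      symm
      refine Finset.prod_subset_one_on_sdiff
        (fun l hl => by simpa using fun h : l = j => hj (h ▸ hl)) ?_ ?_
      · intro l hl
        simp only [Finset.mem_sdiff, Finset.mem_erase] at hl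
        simp [F, hl.1.1, hl.2]
      · intro l hl
        have : l ≠ j := fun h => hj (h ▸ hl)
        simp [F, this, hl]
    rw [h2, Finset.prod_const, hB, ← pow_mul, mul_comm T.card, pow_mul]
    refine pow_le_pow_left₀ (integral_nonneg fun _ => by positivity) ?_ _
    exact integral_one_add_pow_card_inter_le hd hc U
  have hexp (S : Fin n → Finset (Fin m)) :
      ∏ i ∈ S j, (1 + α * ((1 + c) ^ hits S T i - 1)) =
      ∑ A, ∑ U ∈ A.powerset, α ^ U.card * (1 - α) ^ (A \ U).card * ∏ l, F A U l (S l) := by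
    rw [Finset.sum_eq_single (S j)]
    · simp_rw [hF, show ∀ i, 1 + α * ((1 + c) ^ hits S T i - 1) =
        α * (1 + c) ^ hits S T i + (1 - α) from fun i => by ring]
      rw [Finset.prod_add]
      refine Finset.sum_congr rfl fun U _ => ?_
      rw [Finset.prod_mul_distrib, prod_pow_hits, Finset.prod_const, Finset.prod_const]
      simp
      ring
    · intro A _ hA
      refine Finset.sum_eq_zero fun U _ => ?_
      rw [hF, Set.indicator_of_notMem (by simpa using hA.symm)]
      simp
    · simp
  have hprob : IsProbabilityMeasure (columnSupportLaw m n d) := by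
    unfold columnSupportLaw; infer_instance
  simp_rw [hexp]
  rw [integral_finsetSum _ fun _ _ => Integrable.of_finite]
  calc _ ≤ ∑ A, (sliceLaw m d).real {A} * (1 + α * (B - 1)) ^ d := by
        refine Finset.sum_le_sum fun A _ => ?_
        rw [integral_finsetSum _ fun _ _ => Integrable.of_finite]
        simp_rw [integral_const_mul]
        calc _ ≤ ∑ U ∈ A.powerset, α ^ U.card * (1 - α) ^ (A \ U).card *
                ((sliceLaw m d).real {A} * B ^ U.card) := by
              refine Finset.sum_le_sum fun U _ => mul_le_mul_of_nonneg_left (hFint A U) ?_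
              have : 0 ≤ 1 - α := by linarith
              positivity
          _ = (sliceLaw m d).real {A} * (1 + α * (B - 1)) ^ A.card := by
              rw [show 1 + α * (B - 1) = α * B + (1 - α) by ring, ← Finset.prod_const,
                Finset.prod_add, Finset.mul_sum]
              refine Finset.sum_congr rfl fun U _ => ?_
              rw [Finset.prod_const, Finset.prod_const, mul_pow]
              ring
          _ = _ := by
              by_cases h : A.card = d
              · rw [h]
              · simp [sliceLaw_real_singleton_of_card_ne h]
    _ = _ := by
        rw [← Finset.sum_mul, sum_measureReal_singleton]
        simp

/-! ### Tail bound for the excess -/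

lemma rpow_self_le_rpow_mul_exp {x p : ℝ} (hx : 0 ≤ x) (hp : 0 < p) :
    x ^ p ≤ p ^ p * Real.exp x := by
  have h : x / p ≤ Real.exp (x / p) := by linarith [Real.add_one_le_exp (x / p)]
  calc x ^ p = p ^ p * (x / p) ^ p := by
        rw [← Real.mul_rpow hp.le (by positivity), mul_div_cancel₀ _ hp.ne']
    _ ≤ p ^ p * Real.exp (x / p) ^ p := by gcongr
    _ = _ := by rw [← Real.exp_mul, div_mul_cancel₀ _ hp.ne']

/-- Write u for the exponent and use e^u ≤ 1 + u e^u. The hypothesis `h1` gives u ≤ X in the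
exponential, while (1+X)^(p-1) ≤ p^p e^(1+X) bounds the factor u. The base 9 dominates e², and 3·9^X
≤ 4(9^X - 1) for X ≥ 1. -/
lemma exp_mul_rpow_sub_one_le {p lam k : ℝ} (hp : 2 ≤ p) (hlam : 0 ≤ lam) (X : ℕ)
    (hk : 1 + (X : ℝ) ≤ k) (h1 : 2 * lam * k ^ (p - 2) ≤ 1) :
    Real.exp (lam * ((1 + (X : ℝ)) ^ (p - 1) - 1)) ≤
      1 + 4 * lam * p ^ p * ((1 + 8) ^ X - 1) := by
  rcases Nat.eq_zero_or_pos X with rfl | hX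
  · simp
  have hX1 : (1 : ℝ) ≤ X := by exact_mod_cast hX
  set u := lam * ((1 + (X : ℝ)) ^ (p - 1) - 1) with hu
  have hle : (1 + (X : ℝ)) ^ (p - 1) ≤ 2 * X * k ^ (p - 2) := by
    rw [show p - 1 = 1 + (p - 2) by ring, Real.rpow_add (by positivity), Real.rpow_one]
    have : (1 + (X : ℝ)) ^ (p - 2) ≤ k ^ (p - 2) :=
      Real.rpow_le_rpow (by positivity) hk (by linarith)
    gcongr
    linarith
  have huX : u ≤ X := by
    calc u ≤ lam * (2 * X * k ^ (p - 2)) := by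
          rw [hu]; gcongr; linarith
      _ = (2 * lam * k ^ (p - 2)) * X := by ring
      _ ≤ 1 * X := by gcongr
      _ = X := one_mul _
  have hup : u ≤ lam * (p ^ p * Real.exp (1 + X)) := by
    rw [hu]
    gcongr
    have h2 : (1 + (X : ℝ)) ^ (p - 1) ≤ (1 + (X : ℝ)) ^ p :=
      Real.rpow_le_rpow_of_exponent_le (by linarith) (by linarith)
    have h3 := rpow_self_le_rpow_mul_exp (x := 1 + (X : ℝ)) (p := p) (by positivity) (by linarith)
    linarith
  have hexp : Real.exp u ≤ 1 + u * Real.exp u := by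
    have h := mul_le_mul_of_nonneg_right (Real.one_sub_le_exp_neg u) (Real.exp_pos u).le
    rw [← Real.exp_add, neg_add_cancel, Real.exp_zero] at h
    linarith
  have he : Real.exp (1 + X) * Real.exp X ≤ 3 * 9 ^ X := by
    have h3 : Real.exp 1 ≤ 3 := by linarith [Real.exp_one_lt_d9]
    have hX : Real.exp X = Real.exp 1 ^ X := by rw [← Real.exp_nat_mul, mul_one]
    rw [Real.exp_add, mul_assoc, hX, ← mul_pow]
    have : Real.exp 1 * Real.exp 1 ≤ 9 := by nlinarith [Real.exp_pos 1]
    gcongr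
  have h9 : (9 : ℝ) ≤ 9 ^ X := le_self_pow₀ (by norm_num) hX.ne'
  calc Real.exp u ≤ 1 + u * Real.exp u := hexp
    _ ≤ 1 + lam * (p ^ p * Real.exp (1 + X)) * Real.exp X := by gcongr
    _ = 1 + lam * p ^ p * (Real.exp (1 + X) * Real.exp X) := by ring
    _ ≤ 1 + lam * p ^ p * (4 * (9 ^ X - 1)) := by
        have : Real.exp (1 + X) * Real.exp X ≤ 4 * (9 ^ X - 1) := by linarith
        gcongr
    _ = _ := by norm_num; ring

lemma hits_le_card {m n : ℕ} (S : Fin n → Finset (Fin m)) (T : Finset (Fin n)) (i : Fin m) :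
    hits S T i ≤ T.card :=
  Finset.card_filter_le _ _

/-- The total excess multiplicity `∑ ((1 + X)^(p-1) - 1)` of the collisions of column `j` with
the columns in `T`. -/
noncomputable def excess {m n : ℕ} (p : ℝ) (S : Fin n → Finset (Fin m)) (T : Finset (Fin n))
    (j : Fin n) : ℝ :=
  ∑ i ∈ S j, ((1 + (hits S T i : ℝ)) ^ (p - 1) - 1)

lemma isProbabilityMeasure_columnSupportLaw {m d : ℕ} (n : ℕ) (hd : d ≤ m) :
    IsProbabilityMeasure (columnSupportLaw m n d) := by
  have := isProbabilityMeasure_sliceLaw hd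
  unfold columnSupportLaw
  infer_instance

lemma measureReal_excess_gt_le {m n d k : ℕ} {p ε lam : ℝ} (hd : d ≤ m) (hm : 0 < m)
    (hp : 2 ≤ p) (hε : ε ≤ 1) (hlam : 0 ≤ lam) {T : Finset (Fin n)} {j : Fin n} (hj : j ∉ T)
    (hT : T.card + 1 ≤ k) (h1 : 2 * lam * (k : ℝ) ^ (p - 2) ≤ 1) (h2 : 4 * lam * p ^ p ≤ 1)
    (h3 : 128 * p ^ p * k * d ≤ ε * m) :
    (columnSupportLaw m n d).real {S | ε * d < excess p S T j} ≤
      Real.exp (-(lam * ε * d / 2)) := by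
  have := isProbabilityMeasure_columnSupportLaw n hd
  have hm' : (0 : ℝ) < m := by exact_mod_cast hm
  set α := 4 * lam * p ^ p with hα
  have hpp : 1 ≤ p ^ p := Real.one_le_rpow (by linarith) (by linarith)
  have hα0 : 0 ≤ α := by positivity
  set q := (d : ℝ) / m with hq
  have hq0 : 0 ≤ q := by positivity
  have hkq : 128 * p ^ p * (k * q) ≤ ε := by
    rw [hq, ← mul_div_assoc, ← mul_div_assoc, div_le_iff₀ hm', ← mul_assoc]
    exact h3
  have hkq1 : 8 * (k * q) ≤ 1 := by nlinarith [mul_nonneg (Nat.cast_nonneg (α := ℝ) k) hq0]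
  have hB : (1 + 8 * q) ^ T.card - 1 ≤ 16 * (k * q) := by
    have h4 : (1 + 8 * q) ^ T.card ≤ Real.exp (8 * (k * q)) := by
      calc (1 + 8 * q) ^ T.card ≤ (1 + 8 * q) ^ k :=
            pow_le_pow_right₀ (by linarith) (by omega)
        _ ≤ Real.exp (8 * q) ^ k := by
            gcongr
            linarith [Real.add_one_le_exp (8 * q)]
        _ = _ := by rw [← Real.exp_nat_mul]; ring_nf
    have h0 : 0 ≤ 8 * (k * q) := by positivity
    -- On [0, 1], e^t - 1 ≤ 2t; this is where 16 = 2·8 comes from.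
    have h5 := Real.abs_exp_sub_one_le (x := 8 * (k * q)) (by rwa [abs_of_nonneg h0])
    rw [abs_of_nonneg h0] at h5
    linarith [le_abs_self (Real.exp (8 * (k * q)) - 1)]
  have hfin : (1 + α * ((1 + 8 * q) ^ T.card - 1)) ^ d ≤ Real.exp (lam * ε * d / 2) := by
    have hB0 : 0 ≤ (1 + 8 * q) ^ T.card - 1 := by
      linarith [one_le_pow₀ (n := T.card) (show 1 ≤ 1 + 8 * q by linarith)]
    calc _ ≤ (1 + lam * ε / 2) ^ d := by
          gcongr
          calc α * ((1 + 8 * q) ^ T.card - 1) ≤ α * (16 * (k * q)) := by gcongr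
            _ = lam * (128 * p ^ p * (k * q)) / 2 := by rw [hα]; ring
            _ ≤ _ := by gcongr
      _ ≤ Real.exp (lam * ε / 2) ^ d := by
          have : 0 ≤ ε := le_trans (by positivity) hkq
          gcongr
          linarith [Real.add_one_le_exp (lam * ε / 2)]
      _ = _ := by rw [← Real.exp_nat_mul]; ring_nf
  have hmarkov := mul_meas_ge_le_integral_of_nonneg (μ := columnSupportLaw m n d)
    (f := fun S => Real.exp (lam * excess p S T j))
    (Filter.Eventually.of_forall fun _ => (Real.exp_pos _).le) .of_finite
    (Real.exp (lam * (ε * d)))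
  have hint : ∫ S, Real.exp (lam * excess p S T j) ∂columnSupportLaw m n d ≤
      Real.exp (lam * ε * d / 2) := by
    refine le_trans (integral_mono .of_finite .of_finite fun S => ?_)
      ((integral_prod_hits_le hd (c := 8) (by norm_num) hα0 h2 hj).trans hfin)
    simp only [excess, Finset.mul_sum, Real.exp_sum]
    refine Finset.prod_le_prod (fun _ _ => (Real.exp_pos _).le) fun i _ => ?_
    refine exp_mul_rpow_sub_one_le hp hlam _ ?_ h1
    have : hits S T i + 1 ≤ k := by linarith [hits_le_card S T i]
    have : (hits S T i : ℝ) + 1 ≤ k := by exact_mod_cast this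
    linarith
  have hsub : (columnSupportLaw m n d).real {S | ε * d < excess p S T j} ≤
      (columnSupportLaw m n d).real
        {S | Real.exp (lam * (ε * d)) ≤ Real.exp (lam * excess p S T j)} := by
    refine measureReal_mono fun S hS => ?_
    simp only [Set.mem_ofPred_eq, Real.exp_le_exp] at hS ⊢
    gcongr
  refine hsub.trans ?_
  rw [← le_div_iff₀' (Real.exp_pos _)] at hmarkov
  refine hmarkov.trans ((div_le_div_of_nonneg_right hint (Real.exp_pos _).le).trans_eq ?_)
  rw [← Real.exp_sub]
  ring_nf

/-- The law lives on all finsets, so the column size is only an almost sure property and must be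
discarded as a null event. -/
lemma columnSupportLaw_real_card_ne {m d : ℕ} (n : ℕ) (hd : d ≤ m) (j : Fin n) :
    (columnSupportLaw m n d).real {S | (S j).card ≠ d} = 0 := by
  have := isProbabilityMeasure_sliceLaw hd
  have h := (measurePreserving_eval (fun _ : Fin n => sliceLaw m d) j).measureReal_preimage
    (s := {R | R.card ≠ d}) (Set.toFinite _).measurableSet.nullMeasurableSet
  refine h.trans ?_
  have h1 : sliceLaw m d {R | R.card = d} = 1 := by
    refine uniformOn_self (Set.toFinite _) ?_
    rw [← coe_powersetCard_univ, Finset.coe_nonempty]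
    exact Finset.powersetCard_nonempty.2 (by simpa using hd)
  rw [measureReal_def, show {R : Finset (Fin m) | R.card ≠ d} = {R | R.card = d}ᶜ from rfl,
    prob_compl_eq_zero_iff (Set.toFinite _).measurableSet |>.2 h1]
  rfl

/-! ### Deterministic norm bounds -/

lemma lpNormVec_rpow {p : ℝ} (hp : 0 < p) {n : ℕ} (x : Fin n → ℝ) :
    lpNormVec p x ^ p = ∑ j, |x j| ^ p := by
  have hp' : (ENNReal.ofReal p).toReal = p := ENNReal.toReal_ofReal hp.le
  rw [lpNormVec, PiLp.norm_eq_sum (by rwa [hp']), hp', ← Real.rpow_mul (by positivity),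
    one_div_mul_cancel hp.ne', Real.rpow_one]
  rfl

lemma lpNormVec_binaryMatrix_rpow {p : ℝ} (hp : 0 < p) {m n d : ℕ} (S : Fin n → Finset (Fin m))
    (x : Fin n → ℝ) {T : Finset (Fin n)} (hx : ∀ j ∉ T, x j = 0) :
    lpNormVec p (Matrix.mulVec (binaryMatrix p d S) x) ^ p =
      (d : ℝ)⁻¹ * ∑ i, |∑ j ∈ T.filter (i ∈ S ·), x j| ^ p := by
  rw [lpNormVec_rpow hp, Finset.mul_sum]
  refine Finset.sum_congr rfl fun i _ => ?_
  have h : Matrix.mulVec (binaryMatrix p d S) x i =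
      (d : ℝ) ^ (-1 / p) * ∑ j ∈ T.filter (i ∈ S ·), x j := by
    rw [Finset.sum_filter, Finset.mul_sum]
    change ∑ j, binaryMatrix p d S i j * x j = _
    rw [← Finset.sum_subset (Finset.subset_univ T)]
    · refine Finset.sum_congr rfl fun j _ => ?_
      simp [binaryMatrix]
    · intro j _ hj
      simp [hx j hj]
  rw [h, abs_mul, Real.mul_rpow (abs_nonneg _) (abs_nonneg _), abs_of_nonneg (by positivity),
    ← Real.rpow_mul (by positivity), div_mul_cancel₀ _ hp.ne', Real.rpow_neg_one]

lemma sum_hits_weight {m n : ℕ} (S : Fin n → Finset (Fin m)) (T : Finset (Fin n))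
    (w : Fin m → ℝ) (y : Fin n → ℝ) :
    ∑ i, w i * ∑ j ∈ T.filter (i ∈ S ·), y j = ∑ j ∈ T, y j * ∑ i ∈ S j, w i := by
  simp_rw [Finset.sum_filter, Finset.mul_sum]
  rw [Finset.sum_comm]
  refine Finset.sum_congr rfl fun j _ => ?_
  rw [← Finset.sum_subset (Finset.subset_univ (S j))]
  · refine Finset.sum_congr rfl fun i hi => ?_
    rw [if_pos hi, mul_comm]
  · intro i _ hi
    rw [if_neg hi, mul_zero]

lemma sum_hits_rpow {m n d : ℕ} {p : ℝ} {S : Fin n → Finset (Fin m)} {T : Finset (Fin n)}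
    {j : Fin n} (hj : j ∈ T) (hS : (S j).card = d) :
    ∑ i ∈ S j, (hits S T i : ℝ) ^ (p - 1) = d + excess p S (T.erase j) j := by
  classical
  rw [excess, Finset.sum_sub_distrib, Finset.sum_const, hS, nsmul_one, add_sub_cancel]
  refine Finset.sum_congr rfl fun i hi => ?_
  have h : hits S T i = hits S (T.erase j) i + 1 := by
    rw [hits, hits, Finset.filter_erase, Finset.card_erase_add_one]
    simp [hj, hi]
  rw [h, Nat.cast_add, Nat.cast_one, add_comm]

lemma norm_bounds_of_excess_le {m n d : ℕ} {p ε : ℝ} (hp : 2 ≤ p) (hd : 0 < d)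
    {S : Fin n → Finset (Fin m)} {T : Finset (Fin n)} (hS : ∀ j, (S j).card = d)
    (hT : ∀ j ∈ T, excess p S (T.erase j) j ≤ ε * d) {x : Fin n → ℝ} (hx : ∀ j ∉ T, x j = 0) :
    (1 - ε) * lpNormVec p x ^ p ≤ lpNormVec p (Matrix.mulVec (binaryMatrix p d S) x) ^ p ∧
      lpNormVec p (Matrix.mulVec (binaryMatrix p d S) x) ^ p ≤ (1 + ε) * lpNormVec p x ^ p := by
  have hp0 : 0 < p := by linarith
  have hd' : (0 : ℝ) < d := by exact_mod_cast hd
  have hnorm : lpNormVec p x ^ p = ∑ j ∈ T, |x j| ^ p := by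
    rw [lpNormVec_rpow hp0]
    symm
    refine Finset.sum_subset (Finset.subset_univ T) fun j _ hj => ?_
    rw [hx j hj, abs_zero, Real.zero_rpow hp0.ne']
  rw [lpNormVec_binaryMatrix_rpow hp0 S x hx, hnorm]
  constructor
  · rw [← div_eq_inv_mul, le_div_iff₀ hd']
    calc _ = ∑ j ∈ T, |x j| ^ p * (d - ε * d) := by rw [← Finset.sum_mul]; ring
      -- The weight 2 - h^(p-1) equals 1 on rows without collision and is nonpositive for h ≥ 2, so
      -- rows with cancellation can only help.
      _ ≤ ∑ j ∈ T, |x j| ^ p * ∑ i ∈ S j, (2 - (hits S T i : ℝ) ^ (p - 1)) := by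
          refine Finset.sum_le_sum fun j hj => ?_
          gcongr
          rw [Finset.sum_sub_distrib, sum_hits_rpow hj (hS j), Finset.sum_const, hS j,
            nsmul_eq_mul]
          linarith [hT j hj]
      _ = ∑ i, (2 - (hits S T i : ℝ) ^ (p - 1)) * ∑ j ∈ T.filter (i ∈ S ·), |x j| ^ p :=
          (sum_hits_weight S T _ _).symm
      _ ≤ _ := by
          refine Finset.sum_le_sum fun i _ => ?_
          have h0 : 0 ≤ |∑ j ∈ T.filter (i ∈ S ·), x j| ^ p := by positivity
          rcases lt_trichotomy (hits S T i) 1 with h | h | h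
          · have : T.filter (i ∈ S ·) = ∅ := Finset.card_eq_zero.1 (Nat.lt_one_iff.1 h)
            simpa [this] using h0
          · obtain ⟨j, hj⟩ := Finset.card_eq_one.1 h
            rw [h, hj]
            norm_num
          · refine le_trans (mul_nonpos_of_nonpos_of_nonneg ?_ (by positivity)) h0
            have h2 : (2 : ℝ) ≤ hits S T i := by exact_mod_cast h
            have := Real.self_le_rpow_of_one_le (show 1 ≤ (hits S T i : ℝ) by linarith)
              (show 1 ≤ p - 1 by linarith)
            linarith
  · rw [← div_eq_inv_mul, div_le_iff₀ hd']
    calc _ ≤ ∑ i, (hits S T i : ℝ) ^ (p - 1) * ∑ j ∈ T.filter (i ∈ S ·), |x j| ^ p := by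
          refine Finset.sum_le_sum fun i _ => ?_
          refine le_trans ?_ (Real.rpow_sum_le_const_mul_sum_rpow _ _ (by linarith))
          gcongr
          exact Finset.abs_sum_le_sum_abs _ _
      _ = ∑ j ∈ T, |x j| ^ p * ∑ i ∈ S j, (hits S T i : ℝ) ^ (p - 1) := sum_hits_weight S T _ _
      _ ≤ ∑ j ∈ T, |x j| ^ p * (d + ε * d) := by
          refine Finset.sum_le_sum fun j hj => ?_
          gcongr
          rw [sum_hits_rpow hj (hS j)]
          linarith [hT j hj]
      _ = _ := by rw [← Finset.sum_mul]; ring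

/-! ### Union bound -/

lemma measureReal_bad_le {m n d k : ℕ} {p ε : ℝ} (hn : 2 ≤ n) (hk : 1 ≤ k) (hkn : k ≤ n)
    (hd0 : 0 < d) (hd : d ≤ m) (hp : 2 ≤ p) (hε0 : 0 < ε) (hε : ε ≤ 1)
    (h1 : 64 * p ^ p * (k : ℝ) ^ (p - 1) * Real.log n ≤ ε * d)
    (h3 : 128 * p ^ p * k * d ≤ ε * m) :
    (columnSupportLaw m n d).real
      {S | (∃ j, (S j).card ≠ d) ∨ ∃ T : Finset (Fin n), T.card = k ∧
        ∃ j ∈ T, ε * d < excess p S (T.erase j) j} ≤ 1 / 64 := by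
  have := isProbabilityMeasure_columnSupportLaw n hd
  have hd' : (0 : ℝ) < d := by exact_mod_cast hd0
  have hk' : (1 : ℝ) ≤ k := by exact_mod_cast hk
  have hn' : (2 : ℝ) ≤ n := by exact_mod_cast hn
  have hL : 0 < Real.log n := Real.log_pos (by linarith)
  have hpp : 1 ≤ p ^ p := Real.one_le_rpow (by linarith) (by linarith)
  have hkp : (k : ℝ) ^ (p - 1) = k * k ^ (p - 2) := by
    rw [show p - 1 = 1 + (p - 2) by ring, Real.rpow_add (by linarith), Real.rpow_one]
  have hkp2 : 1 ≤ (k : ℝ) ^ (p - 2) := Real.one_le_rpow hk' (by linarith)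
  have hεd : 0 < ε * d := by positivity
  -- Chosen so that λεd/2 = 8k log n.
  set lam := 16 * k * Real.log n / (ε * d) with hlam
  have hlam0 : 0 ≤ lam := by positivity
  have hl1 : 2 * lam * (k : ℝ) ^ (p - 2) ≤ 1 := by
    rw [hlam, mul_div_assoc', div_mul_eq_mul_div, div_le_one hεd]
    refine le_trans ?_ h1
    rw [hkp]
    have : 0 ≤ k * (k : ℝ) ^ (p - 2) * Real.log n := by positivity
    nlinarith [mul_nonneg this (sub_nonneg.2 hpp)]
  have hl2 : 4 * lam * p ^ p ≤ 1 := by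
    rw [hlam, mul_div_assoc', div_mul_eq_mul_div, div_le_one hεd]
    refine le_trans ?_ h1
    rw [hkp]
    have : 0 ≤ p ^ p * k * Real.log n := by positivity
    nlinarith [mul_nonneg this (sub_nonneg.2 hkp2)]
  have htail : Real.exp (-(lam * ε * d / 2)) = ((n : ℝ) ^ (8 * k))⁻¹ := by
    rw [Real.exp_neg, ← Real.exp_log (show (0 : ℝ) < n by linarith), ← Real.exp_nat_mul,
      hlam]
    congr 2
    push_cast
    field_simp
    norm_num
  let I := ((Finset.univ : Finset (Fin n)).powersetCard k).sigma fun T => T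
  have hI : (I.card : ℝ) ≤ (n : ℝ) ^ (2 * k) := by
    have hc : I.card = n.choose k * k := by
      rw [Finset.card_sigma, Finset.sum_const_nat (m := k)]
      · simp
      · intro T hT
        exact (Finset.mem_powersetCard.1 hT).2
    have h2 : n.choose k * k ≤ n ^ k * n ^ k :=
      Nat.mul_le_mul (Nat.choose_le_pow n k) (hkn.trans (Nat.le_self_pow (by omega) n))
    rw [hc, two_mul, pow_add]
    exact_mod_cast h2
  have hsub : {S : Fin n → Finset (Fin m) | (∃ j, (S j).card ≠ d) ∨
      ∃ T : Finset (Fin n), T.card = k ∧ ∃ j ∈ T, ε * d < excess p S (T.erase j) j} ⊆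
      (⋃ j ∈ (Finset.univ : Finset (Fin n)), {S | (S j).card ≠ d}) ∪
      ⋃ a ∈ I, {S | ε * d < excess p S (a.1.erase a.2) a.2} := by
    rintro S (⟨j, hj⟩ | ⟨T, hT, j, hj, h⟩)
    · left
      simpa using ⟨j, hj⟩
    · right
      simp only [Set.mem_iUnion]
      exact ⟨⟨T, j⟩, by simp [I, hT, hj], h⟩
  have hfirst := measureReal_biUnion_finset_le (μ := columnSupportLaw m n d) Finset.univ
    fun j => {S | (S j).card ≠ d}
  simp_rw [columnSupportLaw_real_card_ne n hd] at hfirst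
  have hsecond := measureReal_biUnion_finset_le (μ := columnSupportLaw m n d) I
    fun a => {S | ε * d < excess p S (a.1.erase a.2) a.2}
  have hsum : ∑ a ∈ I, (columnSupportLaw m n d).real
      {S | ε * d < excess p S (a.1.erase a.2) a.2} ≤ I.card • ((n : ℝ) ^ (8 * k))⁻¹ := by
    refine Finset.sum_le_card_nsmul _ _ _ fun a ha => ?_
    simp only [I, Finset.mem_sigma, Finset.mem_powersetCard] at ha
    rw [← htail]
    refine measureReal_excess_gt_le hd (by omega) hp hε hlam0 (Finset.notMem_erase _ _) ?_
      hl1 hl2 h3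
    rw [Finset.card_erase_add_one ha.2, ha.1.2]
  have hpow : (n : ℝ) ^ (2 * k) * ((n : ℝ) ^ (8 * k))⁻¹ ≤ 1 / 64 := by
    have h64 : (64 : ℝ) ≤ n ^ (6 * k) := by
      calc (64 : ℝ) = 2 ^ 6 := by norm_num
        _ ≤ n ^ 6 := by gcongr
        _ ≤ n ^ (6 * k) := pow_le_pow_right₀ (by linarith) (by omega)
    have hn0 : (0 : ℝ) < n := by linarith
    rw [show 8 * k = 2 * k + 6 * k by ring, pow_add, mul_inv, ← mul_assoc,
      mul_inv_cancel₀ (by positivity), one_mul, ← one_div]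
    exact one_div_le_one_div_of_le (by norm_num) h64
  refine (measureReal_mono hsub).trans ((measureReal_union_le _ _).trans ?_)
  have hI' : I.card • ((n : ℝ) ^ (8 * k))⁻¹ ≤ (n : ℝ) ^ (2 * k) * ((n : ℝ) ^ (8 * k))⁻¹ := by
    rw [nsmul_eq_mul]
    gcongr
  simp only [Finset.sum_const_zero] at hfirst
  linarith

/-! ### Choice of m and d -/

lemma exists_rpow_mul_eq {p x y c : ℝ} (hp : 2 ≤ p) (hy : 0 < y) (hyx : y ≤ x)
    (hx : x ≤ p ^ c * y) : ∃ a : ℝ, |a| ≤ c ∧ x = p ^ a * y := by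
  have hp1 : 1 < p := by linarith
  have h1 : 1 ≤ x / y := (one_le_div hy).2 hyx
  have h0 : 0 ≤ Real.logb p (x / y) := Real.logb_nonneg hp1 h1
  refine ⟨Real.logb p (x / y), ?_, ?_⟩
  · rw [abs_of_nonneg h0, Real.logb_le_iff_le_rpow hp1 (by linarith)]
    exact (div_le_iff₀ hy).2 hx
  · rw [Real.rpow_logb (by linarith) hp1.ne' (by linarith), div_mul_cancel₀ _ hy.ne']

lemma exists_nat_between_mul_two {x : ℝ} (hx : 1 ≤ x) : ∃ N : ℕ, x ≤ N ∧ (N : ℝ) ≤ 2 * x :=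
  ⟨⌈x⌉₊, Nat.le_ceil x, by linarith [Nat.ceil_lt_add_one (show 0 ≤ x by linarith)]⟩

lemma exists_dimension_sparsity {n k : ℕ} {ε p : ℝ} (hn : 2 ≤ n) (hk : 1 ≤ k) (hε0 : 0 < ε)
    (hε : ε < 1 / 2) (hp : 2 ≤ p) :
    ∃ m d : ℕ, 0 < m ∧ 0 < d ∧ d ≤ m ∧
      (∃ a : ℝ, |a| ≤ 11 * p ∧
        (m : ℝ) = p ^ a * ((k : ℝ) ^ p / ε ^ 2) * Real.log n ^ (p - 1)) ∧
      (∃ b : ℝ, |b| ≤ 11 * p ∧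
        (d : ℝ) = p ^ b * ((k : ℝ) ^ (p - 1) / ε) * Real.log n ^ (p - 1)) ∧
      64 * p ^ p * (k : ℝ) ^ (p - 1) * Real.log n ≤ ε * d ∧
      128 * p ^ p * k * d ≤ ε * m := by
  have hp0 : 0 < p := by linarith
  have hk' : (1 : ℝ) ≤ k := by exact_mod_cast hk
  have hk0 : (0 : ℝ) < k := by linarith
  have hn' : (2 : ℝ) ≤ n := by exact_mod_cast hn
  have hL : 1 / 2 ≤ Real.log n := by
    linarith [Real.log_two_gt_d9, Real.log_le_log (by norm_num) hn']
  set L := Real.log n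
  have hL0 : 0 < L := by linarith
  have hpp1 : 1 ≤ p ^ p := Real.one_le_rpow (by linarith) hp0.le
  have h2p : (2 : ℝ) ^ p ≤ p ^ p := Real.rpow_le_rpow (by norm_num) hp hp0.le
  -- For n = 2 the logarithm is below 1, so L^(p-1) may be smaller than L; since 2L ≥ 1, a factor
  -- p^p compensates.
  have hLp : L ≤ p ^ p * L ^ (p - 1) := by
    have h1 : 1 ≤ 2 ^ p * L ^ (p - 2) := by
      calc (1 : ℝ) ≤ 2 ^ 2 * (2 * L) ^ (p - 2) := by
            have := Real.one_le_rpow (show 1 ≤ 2 * L by linarith) (show 0 ≤ p - 2 by linarith)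
            linarith
        _ = 2 ^ p * L ^ (p - 2) := by
            rw [Real.mul_rpow (by norm_num) hL0.le, ← mul_assoc, ← Real.rpow_natCast,
              ← Real.rpow_add (by norm_num)]
            norm_num
    have h2 : L ^ (p - 1) = L ^ (p - 2) * L := by
      rw [← Real.rpow_add_one hL0.ne']
      ring_nf
    have h3 : 0 ≤ L ^ (p - 2) := by positivity
    have h4 : 1 ≤ p ^ p * L ^ (p - 2) := by nlinarith
    rw [h2]
    nlinarith
  have hconst : ∀ N : ℕ, (2 : ℝ) ^ N ≤ p ^ (N * (p / 2)) := by
    intro N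
    rw [← Real.rpow_natCast]
    exact (Real.rpow_le_rpow (by norm_num) hp (Nat.cast_nonneg N)).trans
      (Real.rpow_le_rpow_of_exponent_le (by linarith)
        (le_mul_of_one_le_right (Nat.cast_nonneg N) (by linarith)))
  have hpsq : p ^ (2 * p) = p ^ p * p ^ p := by rw [two_mul, Real.rpow_add hp0]
  set Q := (k : ℝ) ^ (p - 1) / ε * L ^ (p - 1) with hQ
  have hQ0 : 0 < Q := by positivity
  have hQ1 : 1 ≤ p ^ p * Q := by
    have h1 : 1 ≤ (k : ℝ) ^ (p - 1) := Real.one_le_rpow hk' (by linarith)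
    have h3 : 1 ≤ (k : ℝ) ^ (p - 1) / ε / 2 := by
      rw [div_div, le_div_iff₀ (by positivity)]
      linarith
    have h4 : 1 ≤ 2 * (p ^ p * L ^ (p - 1)) := by linarith
    rw [hQ]
    nlinarith
  -- One factor p^p is required by the tail bound, the other pays for replacing L by L^(p-1).
  obtain ⟨d, hd1, hd2⟩ := exists_nat_between_mul_two (x := 64 * p ^ (2 * p) * Q) (by
    rw [hpsq]; nlinarith)
  set R := (k : ℝ) ^ p / ε ^ 2 * L ^ (p - 1) with hR
  have hRQ : R = k / ε * Q := by
    rw [hR, hQ, show (k : ℝ) ^ p = k ^ (p - 1) * k by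
      rw [← Real.rpow_add_one hk0.ne']; ring_nf]
    field_simp
  have hR0 : 0 < R := by positivity
  have hd0 : (0 : ℝ) < d := lt_of_lt_of_le (by positivity) hd1
  have hd1' : (1 : ℝ) ≤ d := by
    have : 0 < d := by exact_mod_cast hd0
    exact_mod_cast this
  have hε1 : 1 ≤ k / ε := by rw [le_div_iff₀ hε0]; linarith
  have hfac : 1 ≤ 128 * p ^ p * (k / ε) := by nlinarith
  obtain ⟨m, hm1, hm2⟩ := exists_nat_between_mul_two (x := 128 * p ^ p * (k / ε) * d) (by
    nlinarith)
  have hdm : (d : ℝ) ≤ m := by nlinarith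
  have hdm' : d ≤ m := by exact_mod_cast hdm
  have hdpos : 0 < d := by exact_mod_cast hd0
  refine ⟨m, d, by omega, hdpos, hdm', ?_, ?_, ?_, ?_⟩
  · simp_rw [mul_assoc _ ((k : ℝ) ^ p / ε ^ 2)]
    refine exists_rpow_mul_eq hp hR0 ?_ ?_
    · calc R = k / ε * Q := hRQ
        _ ≤ k / ε * d := by
            gcongr
            refine le_trans ?_ hd1
            rw [hpsq]
            nlinarith [mul_le_mul hpp1 hpp1 zero_le_one (by linarith)]
        _ ≤ m := by
            refine le_trans ?_ hm1
            have : 0 ≤ k / ε * d := by positivity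
            nlinarith
    -- The constant 2^15 costs p^(7.5p) because p ≥ 2; with p^(3p) this makes 10.5p, below 11p.
    · calc (m : ℝ) ≤ 2 * (128 * p ^ p * (k / ε) * d) := hm2
        _ ≤ 2 * (128 * p ^ p * (k / ε) * (2 * (64 * p ^ (2 * p) * Q))) := by gcongr
        _ = 2 ^ 15 * (p ^ p * p ^ (2 * p)) * R := by rw [hRQ]; ring
        _ ≤ p ^ ((15 : ℕ) * (p / 2)) * (p ^ p * p ^ (2 * p)) * R := by
            gcongr
            exact hconst 15
        _ = p ^ (10.5 * p) * R := by
            rw [← Real.rpow_add hp0, ← Real.rpow_add hp0]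
            congr 2
            push_cast
            ring
        _ ≤ _ := by
            gcongr
            · linarith
            · norm_num
  · simp_rw [mul_assoc _ ((k : ℝ) ^ (p - 1) / ε)]
    refine exists_rpow_mul_eq hp hQ0 ?_ ?_
    · refine le_trans ?_ hd1
      rw [hpsq]
      nlinarith [mul_le_mul hpp1 hpp1 zero_le_one (by linarith)]
    · calc (d : ℝ) ≤ 2 * (64 * p ^ (2 * p) * Q) := hd2
        _ = 2 ^ 7 * p ^ (2 * p) * Q := by ring
        _ ≤ p ^ ((7 : ℕ) * (p / 2)) * p ^ (2 * p) * Q := by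
            gcongr
            exact hconst 7
        _ = p ^ (5.5 * p) * Q := by
            rw [← Real.rpow_add hp0]
            congr 2
            push_cast
            ring
        _ ≤ _ := by
            gcongr
            · linarith
            · norm_num
  · calc 64 * p ^ p * (k : ℝ) ^ (p - 1) * L
        ≤ 64 * p ^ p * (k : ℝ) ^ (p - 1) * (p ^ p * L ^ (p - 1)) := by gcongr
      _ = ε * (64 * p ^ (2 * p) * Q) := by rw [hpsq, hQ]; field_simp
      _ ≤ ε * d := by gcongr
  · calc 128 * p ^ p * k * d = ε * (128 * p ^ p * (k / ε) * d) := by field_simp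
      _ ≤ ε * m := by gcongr

/-! ### Conclusion -/

theorem mainTheorem1 :
    ∃ C : ℝ, 0 < C ∧
      ∀ (n k : ℕ) (ε p : ℝ), 2 ≤ n → 1 ≤ k → k ≤ n → 0 < ε → ε < 1 / 2 → 2 ≤ p →
        ∃ m d : ℕ, 0 < m ∧ 0 < d ∧ d ≤ m ∧
          (∃ a : ℝ, |a| ≤ C * p ∧
            (m : ℝ) = p ^ a * ((k : ℝ) ^ p / ε ^ 2) * Real.log n ^ (p - 1)) ∧
          (∃ b : ℝ, |b| ≤ C * p ∧
            (d : ℝ) = p ^ b * ((k : ℝ) ^ (p - 1) / ε) * Real.log n ^ (p - 1)) ∧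
          98 / 100 ≤ (columnSupportLaw m n d).real
            {S | ∀ x : Fin n → ℝ, IsSparse k x →
              (1 - ε) * lpNormVec p x ^ p ≤
                  lpNormVec p (Matrix.mulVec (binaryMatrix p d S) x) ^ p ∧
                lpNormVec p (Matrix.mulVec (binaryMatrix p d S) x) ^ p ≤
                  (1 + ε) * lpNormVec p x ^ p} := by
  refine ⟨11, by norm_num, fun n k ε p hn hk hkn hε0 hε hp => ?_⟩
  obtain ⟨m, d, hm, hdpos, hdm', ha, hb, h1, h3⟩ := exists_dimension_sparsity hn hk hε0 hε hp
  refine ⟨m, d, hm, hdpos, hdm', ha, hb, ?_⟩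
  have := isProbabilityMeasure_columnSupportLaw n hdm'
  have hbad := measureReal_bad_le (ε := ε) (p := p) hn hk hkn hdpos hdm' hp hε0 (by linarith) h1 h3
  have hcompl := measureReal_compl (μ := columnSupportLaw m n d)
    (Set.toFinite {S | (∃ j, (S j).card ≠ d) ∨ ∃ T : Finset (Fin n), T.card = k ∧
      ∃ j ∈ T, ε * d < excess p S (T.erase j) j}).measurableSet
  rw [probReal_univ] at hcompl
  have hle : (98 : ℝ) / 100 ≤ (columnSupportLaw m n d).real
      {S | (∃ j, (S j).card ≠ d) ∨ ∃ T : Finset (Fin n), T.card = k ∧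
        ∃ j ∈ T, ε * d < excess p S (T.erase j) j}ᶜ := by
    rw [hcompl]
    linarith
  refine hle.trans (measureReal_mono fun S hS x hx => ?_)
  simp only [Set.mem_compl_iff, Set.mem_ofPred_eq, not_or, not_exists, not_and, not_lt,
    not_not] at hS
  -- The support is padded to exactly k columns, the only size covered by the union bound.
  obtain ⟨T, hxT, hT⟩ := Finset.exists_superset_card_eq
    (s := Finset.univ.filter fun j => x j ≠ 0) (n := k) hx (by simpa using hkn)
  refine norm_bounds_of_excess_le hp hdpos hS.1 (hS.2 T hT) fun j hj => ?_
  by_contra h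
  exact hj (hxT (by simpa using h))
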